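/- Write $\mathbb{R}^\infty=\bigcup_{n\ge 0}\mathbb{R}^n$ for the set of all finite tuples of real numbers. An oracle BSS machine (over the ordered field $\mathbb{R}$) has a finite program, with finitely many real parameters; it can copy cells, write parameters into cells, add, subtract, multiply and divide the contents of cells, fork according to whether the content of a cell is $<0$, $=0$ or $>0$, and fork according to whether a tuple stored in its cells belongs to the oracle set. For $C,B\subseteq\mathbb{R}^\infty$, write $C\le_{\mathrm{BSS}}B$ if some oracle BSS machine with oracle set $B$ halts on every input $x\in\mathbb{R}^\infty$ and outputs the value $\chi_C(x)\in\{0,1\}$ of the characteristic function of $C$. For a set $S$ of positive integers let $\mathbb{A}_S\subseteq\mathbb{R}\subseteq\mathbb{R}^\infty$ be the set of real numbers that are algebraic over $\mathbb{Q}$ and whose degree over $\mathbb{Q}$ lies in $S$. **Proposition.** Let $S$ and $T$ be sets of positive integers. Suppose that there is a constant $N$ such that for each $d\in S$ there is a positive integer $n_d\le N$, coprime to $d$, with $d\,n_d\in T$. Then $\mathbb{A}_S\le_{\mathrm{BSS}}\mathbb{A}_T$. -/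

import Mathlib

/-!
Oracle Blum-Shub-Smale machines over the ordered field of real numbers.

The space of finite tuples of real numbers is `List ℝ`. A machine is a finite flowchart. Its memory
consists of real cells indexed by `ℕ` and of two index registers `i`, `j` with values in `ℕ`, which
serve only for indirect copying (they are what lets a fixed program treat tuples of any length).
-/

namespace BSS

/-- The instructions at the nodes of a flowchart with set of nodes `ν`. The arguments `a b c : ℕ`
are addresses of cells; the arguments of type `ν` are the possible next nodes. -/
inductive Instr (ν : Type) : Type where
  /-- `cell a := r`, where the real number `r` is a parameter of the program -/
  | const (a : ℕ) (r : ℝ) (next : ν)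
  /-- `cell a := cell b` -/
  | copy (a b : ℕ) (next : ν)
  /-- `cell a := cell b + cell c` -/
  | add (a b c : ℕ) (next : ν)
  /-- `cell a := cell b - cell c` -/
  | sub (a b c : ℕ) (next : ν)
  /-- `cell a := cell b * cell c` -/
  | mul (a b c : ℕ) (next : ν)
  /-- `cell a := cell b / cell c`; if `cell c = 0`, the machine hangs forever -/
  | div (a b c : ℕ) (next : ν)
  /-- `i := 0` -/
  | resetI (next : ν)
  /-- `i := i + 1` -/
  | incI (next : ν)
  /-- `j := 0` -/
  | resetJ (next : ν)
  /-- `j := j + 1` -/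
  | incJ (next : ν)
  /-- `cell j := cell i`, the addresses being the current contents of the index registers -/
  | copyIndirect (next : ν)
  /-- fork according to whether `cell a` is less than, equal to, or greater than `0` -/
  | fork (a : ℕ) (lt eq gt : ν)
  /-- fork according to whether the tuple stored from address `a` on belongs to the oracle set -/
  | query (a : ℕ) (yes no : ν)
  /-- stop -/
  | halt

/-- An oracle machine: a finite flowchart (hence with only finitely many real parameters) with a
start node. The oracle set is not part of the machine. -/
structure Machine where
  /-- the nodes -/
  Node : Type
  /-- there are only finitely many nodes -/
  finite_node : Finite Node
  /-- the start node -/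
  start : Node
  /-- the instruction at each node -/
  instr : Node → Instr Node

/-- A configuration: current node, index registers, contents of the cells. -/
structure Config (ν : Type) where
  /-- the current node -/
  node : ν
  /-- the first index register -/
  i : ℕ
  /-- the second index register -/
  j : ℕ
  /-- the contents of the cells -/
  cell : ℕ → ℝ

/-- The cells from address `a` on store the tuple `y`: cell `a` contains its length `n`, and the
cells `a + 1, …, a + n` contain its entries. There is at most one such `y`. -/
def Stores (cell : ℕ → ℝ) (a : ℕ) (y : List ℝ) : Prop :=
  cell a = (y.length : ℝ) ∧ ∀ k (hk : k < y.length), cell (a + 1 + k) = y[k]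

namespace Machine

open Classical in
/-- One step of the computation with oracle set `B`. At a halting node, and when a division by zero
is attempted, the configuration no longer changes; the latter does not count as halting. A query
is answered positively exactly when the cells queried store a tuple that belongs to `B`. -/
noncomputable def step (M : Machine) (B : Set (List ℝ)) (s : Config M.Node) : Config M.Node :=
  match M.instr s.node with
  | .const a r q => { s with node := q, cell := Function.update s.cell a r }
  | .copy a b q => { s with node := q, cell := Function.update s.cell a (s.cell b) }
  | .add a b c q => { s with node := q, cell := Function.update s.cell a (s.cell b + s.cell c) }
  | .sub a b c q => { s with node := q, cell := Function.update s.cell a (s.cell b - s.cell c) }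
  | .mul a b c q => { s with node := q, cell := Function.update s.cell a (s.cell b * s.cell c) }
  | .div a b c q =>
      if s.cell c = 0 then s
      else { s with node := q, cell := Function.update s.cell a (s.cell b / s.cell c) }
  | .resetI q => { s with node := q, i := 0 }
  | .incI q => { s with node := q, i := s.i + 1 }
  | .resetJ q => { s with node := q, j := 0 }
  | .incJ q => { s with node := q, j := s.j + 1 }
  | .copyIndirect q => { s with node := q, cell := Function.update s.cell s.j (s.cell s.i) }
  | .fork a lt eq gt =>
      { s with node := if s.cell a < 0 then lt else if s.cell a = 0 then eq else gt }
  | .query a yes no => { s with node := if ∃ y ∈ B, Stores s.cell a y then yes else no }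
  | .halt => s

/-- The initial configuration on input `x`: start node, both index registers `0`, the length of `x`
in cell `0`, the entries of `x` in the cells `1, …, x.length`, and `0` in all other cells. -/
def initialConfig (M : Machine) (x : List ℝ) : Config M.Node where
  node := M.start
  i := 0
  j := 0
  cell := fun k => if k = 0 then (x.length : ℝ) else x.getD (k - 1) 0

/-- On input `x` and with oracle set `B`, the machine halts after finitely many steps with output
`y`; the output is the tuple stored from cell `0` on. -/
def Outputs (M : Machine) (B : Set (List ℝ)) (x y : List ℝ) : Prop :=
  ∃ t : ℕ, M.instr ((M.step B)^[t] (M.initialConfig x)).node = Instr.halt ∧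
    Stores ((M.step B)^[t] (M.initialConfig x)).cell 0 y

/-- With oracle set `B`, the machine computes the total function `f`. -/
def Computes (M : Machine) (B : Set (List ℝ)) (f : List ℝ → List ℝ) : Prop :=
  ∀ x : List ℝ, M.Outputs B x (f x)

end Machine

open Classical in
/-- The characteristic function of a set of tuples, with values the 1-tuples `1` and `0`. -/
noncomputable def charFun (C : Set (List ℝ)) (x : List ℝ) : List ℝ :=
  if x ∈ C then [1] else [0]

/-- `C ≤_BSS B`: some oracle machine with oracle set `B` computes the characteristic function
of `C`. -/
def Reducible (C B : Set (List ℝ)) : Prop :=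
  ∃ M : Machine, M.Computes B (charFun C)

/-- `𝔸_S`, the set of real algebraic numbers whose degree over `ℚ` belongs to `S`, regarded as a
set of 1-tuples. -/
def algebraicOfDegree (S : Set ℕ) : Set (List ℝ) :=
  {y | ∃ x : ℝ, y = [x] ∧ IsAlgebraic ℚ x ∧ (minpoly ℚ x).natDegree ∈ S}

end BSS

/-! If `x` has degree `d` over `ℚ` and `b` has degree `n` coprime to `d`, then `x + b` has degree `d
* n` (`natDegree_minpoly_add`). So let the machine ask whether `x + b n` lies in `𝔸_T`, with a fixed
algebraic parameter `b n` of degree `n` for each positive `n ≤ N`; the bound `N` keeps the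
parameters finite in number. If `x ∈ 𝔸_S`, some answer is positive, so the machine may reject when
all are negative.

A positive answer for an arbitrary `n` shows only that `x` is algebraic, but this suffices: a search
for an integer polynomial vanishing at `x` is then sure to end (`haltsWith_read_programs`). As `S`
may be undecidable, knowledge of it is stored in one further real parameter. Its decimal digits list
integer polynomials as straight-line programs, each followed by a bit telling whether the degrees of
its real zeros lie in `S` (`exists_sound_enumeration`). The first polynomial that vanishes at `x`
yields the answer. -/

/-! ### Degrees of sums of algebraic numbers -/

open Polynomial in
theorem AlgHom.apply_mem_rootSet_minpoly {F L A : Type*} [Field F] [Field L] [Algebra F L]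
    [FiniteDimensional F L] [Field A] [Algebra F A] (φ : L →ₐ[F] A) (z : L) :
    φ z ∈ (minpoly F z).rootSet A := by
  rw [mem_rootSet]
  exact ⟨minpoly.ne_zero (Algebra.IsIntegral.isIntegral z), by
    rw [aeval_algHom_apply, minpoly.aeval, map_zero]⟩

open IntermediateField in
theorem AlgHom.eq_of_sup_adjoin_simple_eq_top {F L A : Type*} [Field F] [Field L] [Algebra F L]
    [Field A] [Algebra F A] {φ ψ : L →ₐ[F] A} {x y : L} (hgen : F⟮x⟯ ⊔ F⟮y⟯ = ⊤)
    (hx : φ x = ψ x) (hy : φ y = ψ y) : φ = ψ := by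
  have hle : F⟮x⟯ ⊔ F⟮y⟯ ≤ (AlgHom.equalizer φ ψ).toIntermediateField
      (fun z hz => by
        have hz' : φ z = ψ z := hz
        change φ z⁻¹ = ψ z⁻¹
        rw [map_inv₀, map_inv₀, hz']) := by
    rw [sup_le_iff, adjoin_simple_le_iff, adjoin_simple_le_iff]
    exact ⟨hx, hy⟩
  rw [hgen] at hle
  ext z
  exact hle (mem_top (x := z))

open Polynomial IntermediateField Module in
-- An embedding is determined by the pair of conjugates to which it sends `x` and `y`. By
-- separability there are as many embeddings as there are pairs, so every pair occurs.
theorem exists_algHom_apply_eq {F L : Type*} [Field F] [CharZero F] [Algebra F ℂ]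
    [Field L] [Algebra F L] [FiniteDimensional F L]
    (x y : L) (hgen : F⟮x⟯ ⊔ F⟮y⟯ = ⊤)
    (hdeg : finrank F L = (minpoly F x).natDegree * (minpoly F y).natDegree)
    {α β : ℂ} (hα : α ∈ (minpoly F x).rootSet ℂ) (hβ : β ∈ (minpoly F y).rootSet ℂ) :
    ∃ φ : L →ₐ[F] ℂ, φ x = α ∧ φ y = β := by
  have hcard (z : L) : Fintype.card ((minpoly F z).rootSet ℂ) = (minpoly F z).natDegree :=
    card_rootSet_eq_natDegree (Algebra.IsSeparable.isSeparable F z) (IsAlgClosed.splits _)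
  let G : (L →ₐ[F] ℂ) → (minpoly F x).rootSet ℂ × (minpoly F y).rootSet ℂ :=
    fun φ => (⟨φ x, φ.apply_mem_rootSet_minpoly x⟩, ⟨φ y, φ.apply_mem_rootSet_minpoly y⟩)
  have hinj : Function.Injective G := by
    intro φ ψ h
    simp only [G, Prod.mk.injEq, Subtype.mk.injEq] at h
    exact AlgHom.eq_of_sup_adjoin_simple_eq_top hgen h.1 h.2
  have hbij : Function.Bijective G := by
    rw [Fintype.bijective_iff_injective_and_card, Fintype.card_prod, hcard, hcard, AlgHom.card]
    exact ⟨hinj, hdeg⟩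
  obtain ⟨φ, hφ⟩ := hbij.2 (⟨α, hα⟩, ⟨β, hβ⟩)
  simp only [G, Prod.mk.injEq, Subtype.mk.injEq] at hφ
  exact ⟨φ, hφ⟩

open Polynomial in
-- The lexicographic order on `ℂ` is total and compatible with addition, so a sum of two conjugates
-- equals the sum of the two maxima only if both are maximal.
theorem exists_rootSet_lex_max {F : Type*} [Field F] [Algebra F ℂ] {p : F[X]} (hp : 0 < p.natDegree) :
    ∃ α ∈ p.rootSet ℂ, ∀ z ∈ p.rootSet ℂ, toLex (z.re, z.im) ≤ toLex (α.re, α.im) := by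
  obtain ⟨α, hα⟩ := Complex.exists_root (f := p.map (algebraMap F ℂ))
    (by rw [degree_map]; exact natDegree_pos_iff_degree_pos.1 hp)
  have hne : (p.rootSet ℂ).Nonempty := ⟨α, by
    rw [mem_rootSet, aeval_def, ← eval_map]
    exact ⟨ne_zero_of_natDegree_gt hp, hα⟩⟩
  exact Set.exists_max_image _ _ (rootSet_finite p ℂ) hne

open Polynomial IntermediateField Module in
/-- If `F(x, y)` has degree `deg x * deg y`, then `x + y` generates it: the embedding into `ℂ`
sending `x` and `y` to their lexicographically largest conjugates is determined by its value at
`x + y`. -/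
theorem adjoin_add_eq_top {F L : Type*} [Field F] [CharZero F] [Algebra F ℂ]
    [Field L] [Algebra F L] [FiniteDimensional F L]
    (x y : L) (hgen : F⟮x⟯ ⊔ F⟮y⟯ = ⊤)
    (hdeg : finrank F L = (minpoly F x).natDegree * (minpoly F y).natDegree) :
    F⟮x + y⟯ = ⊤ := by
  have hpos (z : L) : 0 < (minpoly F z).natDegree :=
    minpoly.natDegree_pos (Algebra.IsIntegral.isIntegral z)
  obtain ⟨α, hα, hαmax⟩ := exists_rootSet_lex_max (hpos x)
  obtain ⟨β, hβ, hβmax⟩ := exists_rootSet_lex_max (hpos y)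
  obtain ⟨φ, hφx, hφy⟩ := exists_algHom_apply_eq x y hgen hdeg hα hβ
  rw [Field.primitive_element_iff_algHom_eq_of_eval F ℂ (fun _ => IsAlgClosed.splits _) _ φ]
  intro ψ h
  rw [map_add, map_add, hφx, hφy] at h
  have h1 := hαmax _ (ψ.apply_mem_rootSet_minpoly x)
  have h2 := hβmax _ (ψ.apply_mem_rootSet_minpoly y)
  have hx : ψ x = α := by
    have hre := congrArg Complex.re h
    have him := congrArg Complex.im h
    rw [Complex.add_re, Complex.add_re] at hre
    rw [Complex.add_im, Complex.add_im] at him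
    rw [Prod.Lex.toLex_le_toLex] at h1 h2
    dsimp only at h1 h2
    apply Complex.ext
    · rcases h1 with h1 | h1 <;> rcases h2 with h2 | h2 <;> linarith
    · rcases h1 with h1 | h1 <;> rcases h2 with h2 | h2 <;> linarith
  have hy : ψ y = β := by
    rw [hx] at h
    exact (add_left_cancel h).symm
  exact AlgHom.eq_of_sup_adjoin_simple_eq_top hgen (hφx.trans hx.symm) (hφy.trans hy.symm)

open Polynomial IntermediateField Module in
-- Coprime degrees make `F⟮x⟯` and `F⟮y⟯` linearly disjoint, so their compositum has the product
-- degree, and `x + y` generates it by `adjoin_add_eq_top`.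
theorem natDegree_minpoly_add {F E : Type*} [Field F] [CharZero F] [Algebra F ℂ]
    [Field E] [Algebra F E] {x y : E}
    (hx : IsIntegral F x) (hy : IsIntegral F y)
    (h : (minpoly F x).natDegree.Coprime (minpoly F y).natDegree) :
    (minpoly F (x + y)).natDegree = (minpoly F x).natDegree * (minpoly F y).natDegree := by
  have := adjoin.finiteDimensional hx
  have := adjoin.finiteDimensional hy
  have hsup : finrank F ↥(F⟮x⟯ ⊔ F⟮y⟯) =
      (minpoly F x).natDegree * (minpoly F y).natDegree := by
    rw [← adjoin.finrank hx, ← adjoin.finrank hy]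
    refine (LinearDisjoint.of_finrank_coprime (A := F⟮x⟯) (L := F⟮y⟯) ?_).finrank_sup
    rw [adjoin.finrank hx]
    have hfy := adjoin.finrank hy
    rw [← hfy] at h
    exact h
  let L := F⟮x⟯ ⊔ F⟮y⟯
  let x' : L := ⟨x, (le_sup_left : F⟮x⟯ ≤ L) (mem_adjoin_simple_self F x)⟩
  let y' : L := ⟨y, (le_sup_right : F⟮y⟯ ≤ L) (mem_adjoin_simple_self F y)⟩
  have hval (z : L) : minpoly F z = minpoly F (z : E) :=
    (minpoly.algebraMap_eq (algebraMap L E).injective z).symm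
  have hgen : F⟮x'⟯ ⊔ F⟮y'⟯ = ⊤ := by
    -- Both sides have image `L` in `E`.
    apply IntermediateField.map_injective L.val
    rw [IntermediateField.map_sup, adjoin_map, adjoin_map, Set.image_singleton,
      Set.image_singleton, ← AlgHom.fieldRange_eq_map, fieldRange_val]
    rfl
  have htop := adjoin_add_eq_top x' y' hgen (by rw [hval, hval]; exact hsup)
  have hint : IsIntegral F (x' + y') := Algebra.IsIntegral.isIntegral _
  have hfr := adjoin.finrank hint
  rw [htop, finrank_top', hsup, hval] at hfr
  exact hfr.symm

open Polynomial in
-- The real `n`-th root of `2` serves, by Eisenstein's criterion at `2` and Gauss's lemma.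
theorem exists_real_natDegree_minpoly_eq {n : ℕ} (hn : 0 < n) :
    ∃ x : ℝ, IsAlgebraic ℚ x ∧ (minpoly ℚ x).natDegree = n := by
  have hmonic : (X ^ n - C (2 : ℤ)).Monic := monic_X_pow_sub_C _ hn.ne'
  have hirr : Irreducible (X ^ n - C (2 : ℤ)) := by
    have hprime : (Ideal.span {(2 : ℤ)}).IsPrime :=
      (Ideal.span_singleton_prime two_ne_zero).2 Int.prime_two
    have hdegree : (X ^ n - C (2 : ℤ)).degree = (n : WithBot ℕ) := degree_X_pow_sub_C hn _
    refine irreducible_of_eisenstein_criterion hprime ?_ ?_ ?_ ?_ hmonic.isPrimitive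
    · rw [hmonic.leadingCoeff, Ideal.mem_span_singleton]
      norm_num
    · intro k hk
      rw [hdegree, Nat.cast_lt] at hk
      rw [coeff_sub, coeff_X_pow, if_neg hk.ne, coeff_C, Ideal.mem_span_singleton]
      split_ifs <;> norm_num
    · rw [hdegree]
      exact_mod_cast hn
    · rw [coeff_sub, coeff_X_pow, if_neg hn.ne, coeff_C_zero, Ideal.span_singleton_pow,
        Ideal.mem_span_singleton]
      norm_num
  have hirr' : Irreducible (X ^ n - C (2 : ℚ)) := by
    have := (IsPrimitive.Int.irreducible_iff_irreducible_map_cast hmonic.isPrimitive).1 hirr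
    rwa [Polynomial.map_sub, Polynomial.map_pow, map_X, map_C, eq_intCast, Int.cast_ofNat] at this
  have hroot : aeval ((2 : ℝ) ^ (n : ℝ)⁻¹) (X ^ n - C (2 : ℚ)) = 0 := by
    simp [Real.rpow_inv_natCast_pow (zero_le_two : (0 : ℝ) ≤ 2) hn.ne']
  refine ⟨(2 : ℝ) ^ (n : ℝ)⁻¹, ⟨_, hirr'.ne_zero, hroot⟩, ?_⟩
  rw [← minpoly.eq_of_irreducible_of_monic hirr' hroot (monic_X_pow_sub_C _ hn.ne'),
    natDegree_X_pow_sub_C]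

/-! ### Straight-line programs for integer polynomials -/

namespace BSS

/-- The effect on the accumulator of the arithmetic instruction coded by a digit: multiply by `x`,
add one, subtract one. The digits `3` and `4` code zero tests, which have no effect here. -/
def opEval (x : ℝ) (a : ℝ) (k : Fin 5) : ℝ :=
  match k with
  | 0 => a * x
  | 1 => a + 1
  | 2 => a - 1
  | 3 => a
  | 4 => a

/-- The value of the accumulator after a straight-line program, starting from `0`. -/
def progEval (l : List (Fin 5)) (x : ℝ) : ℝ :=
  l.foldl (opEval x) 0

theorem foldl_opEval_replicate_one (x a : ℝ) (n : ℕ) :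
    (List.replicate n (1 : Fin 5)).foldl (opEval x) a = a + n := by
  induction n generalizing a with
  | zero => simp
  | succ n ih => rw [List.replicate_succ, List.foldl_cons, ih]; simp only [opEval]; push_cast; ring

theorem foldl_opEval_replicate_two (x a : ℝ) (n : ℕ) :
    (List.replicate n (2 : Fin 5)).foldl (opEval x) a = a - n := by
  induction n generalizing a with
  | zero => simp
  | succ n ih => rw [List.replicate_succ, List.foldl_cons, ih]; simp only [opEval]; push_cast; ring

open Polynomial in
/-- Every integer polynomial is evaluated by a straight-line program (Horner's scheme). -/
theorem exists_progEval_eq_aeval (p : ℤ[X]) :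
    ∃ l : List (Fin 5), (∀ k ∈ l, k < 3) ∧ ∀ x : ℝ, progEval l x = aeval x p := by
  induction p using Polynomial.recOnHorner with
  | M0 => exact ⟨[], by simp, fun x => by simp [progEval]⟩
  | MC p a _ _ ih =>
    obtain ⟨l, hl, h⟩ := ih
    simp only [progEval] at h
    obtain ⟨n, rfl | rfl⟩ := a.eq_nat_or_neg
    · refine ⟨l ++ List.replicate n 1, ?_, fun x => ?_⟩
      · intro k hk
        rcases List.mem_append.1 hk with hk | hk
        · exact hl k hk
        · rw [List.eq_of_mem_replicate hk]; decide
      · rw [progEval, List.foldl_append, foldl_opEval_replicate_one, h]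
        simp
    · refine ⟨l ++ List.replicate n 2, ?_, fun x => ?_⟩
      · intro k hk
        rcases List.mem_append.1 hk with hk | hk
        · exact hl k hk
        · rw [List.eq_of_mem_replicate hk]; decide
      · rw [progEval, List.foldl_append, foldl_opEval_replicate_two, h]
        simp [sub_eq_add_neg]
  | MX p _ ih =>
    obtain ⟨l, hl, h⟩ := ih
    simp only [progEval] at h
    refine ⟨l ++ [0], ?_, fun x => ?_⟩
    · intro k hk
      rcases List.mem_append.1 hk with hk | hk
      · exact hl k hk
      · rw [List.mem_singleton.1 hk]; decide
    · rw [progEval, List.foldl_append, h]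
      simp [opEval]

/-- A program paired with an answer is sound for `S` if, for every real zero of the program, the
answer tells whether the degree of this zero belongs to `S`. -/
def Sound (S : Set ℕ) (q : List (Fin 5) × Bool) : Prop :=
  (∀ k ∈ q.1, k < 3) ∧
    ∀ x : ℝ, progEval q.1 x = 0 → (q.2 = true ↔ (minpoly ℚ x).natDegree ∈ S)

open Polynomial in
-- All real zeros of the minimal polynomial of `x` have this same minimal polynomial, so one bit is
-- right for all of them.
theorem exists_sound_of_isAlgebraic (S : Set ℕ) {x : ℝ} (hx : IsAlgebraic ℚ x) :
    ∃ q, Sound S q ∧ progEval q.1 x = 0 := by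
  classical
  have hint : IsIntegral ℚ x := hx.isIntegral
  obtain ⟨c, hcmem, hc⟩ := IsLocalization.integerNormalization_spec (nonZeroDivisors ℤ)
    (minpoly ℚ x)
  have hc0 : c ≠ 0 := nonZeroDivisors.ne_zero hcmem
  -- Clearing denominators multiplies by the nonzero integer `c` and keeps the zeros.
  have hzero (y : ℝ) : aeval y (IsLocalization.integerNormalization (nonZeroDivisors ℤ)
      (minpoly ℚ x)) = 0 ↔ aeval y (minpoly ℚ x) = 0 := by
    rw [← aeval_map_algebraMap ℚ y, hc, map_zsmul, smul_eq_zero, or_iff_right hc0]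
  obtain ⟨l, hl, h⟩ := exists_progEval_eq_aeval
    (IsLocalization.integerNormalization (nonZeroDivisors ℤ) (minpoly ℚ x))
  refine ⟨(l, decide ((minpoly ℚ x).natDegree ∈ S)), ⟨hl, fun y hy => ?_⟩, ?_⟩
  · rw [h, hzero] at hy
    rw [← minpoly.eq_of_irreducible_of_monic (minpoly.irreducible hint) hy (minpoly.monic hint)]
    exact decide_eq_true_iff
  · rw [h, hzero, minpoly.aeval]

/-- There are only countably many programs; the enumeration need not be computable. -/
theorem exists_sound_enumeration (S : Set ℕ) :
    ∃ g : ℕ → List (Fin 5) × Bool, (∀ m, Sound S (g m)) ∧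
      ∀ x : ℝ, IsAlgebraic ℚ x → ∃ m, progEval (g m).1 x = 0 := by
  have : Nonempty {q // Sound S q} := by
    obtain ⟨q, hq, -⟩ := exists_sound_of_isAlgebraic S (x := 0) isAlgebraic_zero
    exact ⟨⟨q, hq⟩⟩
  obtain ⟨g, hg⟩ := exists_surjective_nat {q // Sound S q}
  refine ⟨fun m => g m, fun m => (g m).2, fun x hx => ?_⟩
  obtain ⟨q, hq, hqx⟩ := exists_sound_of_isAlgebraic S hx
  obtain ⟨m, hm⟩ := hg ⟨q, hq⟩
  exact ⟨m, by simpa only [hm] using hqx⟩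

/-! ### Coding the list of programs in one real number -/

section Stream

variable (g : ℕ → List (Fin 5) × Bool)

/-- The first digit of the rest of the digit stream, in the state `(m, l)`: the instructions `l` of
the `m`-th program remain to be emitted, followed by the zero test giving the `m`-th answer. -/
def streamHead : ℕ × List (Fin 5) → Fin 5
  | (_, k :: _) => k
  | (m, []) => if (g m).2 then 3 else 4

/-- The state of the digit stream after emitting one digit. -/
def streamNext : ℕ × List (Fin 5) → ℕ × List (Fin 5)
  | (m, _ :: l) => (m, l)
  | (m, []) => (m + 1, (g (m + 1)).1)

/-- The real number whose decimal digits are those of the digit stream. -/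
noncomputable def streamValue (σ : ℕ × List (Fin 5)) : ℝ :=
  ∑' n : ℕ, ((streamHead g ((streamNext g)^[n] σ) : ℕ) : ℝ) * (1 / 10) ^ n

theorem streamTerm_le (σ : ℕ × List (Fin 5)) (n : ℕ) :
    ((streamHead g ((streamNext g)^[n] σ) : ℕ) : ℝ) * (1 / 10) ^ n ≤ 4 * (1 / 10) ^ n := by
  have h : (streamHead g ((streamNext g)^[n] σ) : ℕ) ≤ 4 := by omega
  have h' : ((streamHead g ((streamNext g)^[n] σ) : ℕ) : ℝ) ≤ 4 := by exact_mod_cast h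
  gcongr

theorem summable_streamTerm (σ : ℕ × List (Fin 5)) :
    Summable fun n : ℕ => ((streamHead g ((streamNext g)^[n] σ) : ℕ) : ℝ) * (1 / 10) ^ n :=
  Summable.of_nonneg_of_le (fun _ => by positivity) (streamTerm_le g σ)
    ((summable_geometric_of_lt_one (by norm_num) (by norm_num)).mul_left 4)

theorem streamValue_nonneg (σ : ℕ × List (Fin 5)) : 0 ≤ streamValue g σ :=
  tsum_nonneg fun _ => by positivity

/-- Digits are at most `4`, so the value is at most `40 / 9`. Hence the part after the leading digit
is less than one, and that digit can be read off by repeated subtraction of one. -/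
theorem streamValue_lt (σ : ℕ × List (Fin 5)) : streamValue g σ < 10 := by
  have h := (summable_streamTerm g σ).tsum_le_tsum (streamTerm_le g σ)
    ((summable_geometric_of_lt_one (by norm_num) (by norm_num)).mul_left 4)
  rw [tsum_mul_left, tsum_geometric_of_lt_one (by norm_num) (by norm_num)] at h
  exact h.trans_lt (by norm_num)

theorem streamValue_eq (σ : ℕ × List (Fin 5)) :
    streamValue g σ = ((streamHead g σ : ℕ) : ℝ) + streamValue g (streamNext g σ) / 10 := by
  rw [streamValue, (summable_streamTerm g σ).tsum_eq_zero_add, streamValue,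
    ← tsum_div_const]
  congr 1
  · simp
  · refine tsum_congr fun n => ?_
    rw [Function.iterate_succ_apply, pow_succ]
    ring

end Stream

/-! ### The machine -/

/-- The nodes of the machine deciding `algebraicOfDegree S`. -/
inductive Node (N : ℕ) : Type
  | start | lenSub | lenFork
  | load (n : Fin (N + 1)) | translate (n : Fin (N + 1)) | ask (n : Fin (N + 1))
  | initAcc | initStream | initBase
  | read (k : Fin 5) | compare (k : Fin 5) | decrement (k : Fin 5) | take (k : Fin 5)
  | exec (k : Fin 5) | clear
  | answerLen (b : Bool) | answer (b : Bool) | done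
  deriving Fintype

/-- The machine deciding `algebraicOfDegree S`. It rejects tuples of length other than one. For an
input `x` it asks whether one of the numbers `x + b n` belongs to the oracle set, and rejects if
not. Otherwise it executes the instructions coded by the decimal digits of `r`. The cells `1` to `6`
contain `x`, the number one, the accumulator, the rest of the digit stream, an auxiliary value and
the number ten; in the querying phase, the cells `2` and `3` store the tuple queried. -/
noncomputable def decider (N : ℕ) (b : ℕ → ℝ) (r : ℝ) : Machine where
  Node := Node N
  finite_node := inferInstance
  start := .start
  instr
    | .start => .const 2 1 .lenSub
    | .lenSub => .sub 3 0 2 .lenFork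
    | .lenFork => .fork 3 (.answerLen false) (.load 0) (.answerLen false)
    | .load n => .const 4 (b n) (.translate n)
    | .translate n => .add 3 1 4 (.ask n)
    | .ask n => .query 2 .initAcc
        (if h : (n : ℕ) < N then .load ⟨n + 1, Nat.succ_lt_succ h⟩ else .answerLen false)
    | .initAcc => .const 3 0 .initStream
    | .initStream => .const 4 r .initBase
    | .initBase => .const 6 10 (.read 0)
    | .read k => .sub 5 4 2 (.compare k)
    | .compare k => .fork 5 (.take k) (.decrement k) (.decrement k)
    | .decrement k => .copy 4 5 (.read (k + 1))
    | .take k => .mul 4 4 6 (.exec k)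
    | .exec 0 => .mul 3 3 1 (.read 0)
    | .exec 1 => .add 3 3 2 (.read 0)
    | .exec 2 => .sub 3 3 2 (.read 0)
    | .exec 3 => .fork 3 .clear (.answerLen true) .clear
    | .exec 4 => .fork 3 .clear (.answerLen false) .clear
    | .clear => .const 3 0 (.read 0)
    | .answerLen c => .const 0 1 (.answer c)
    | .answer c => .const 1 (if c then 1 else 0) .done
    | .done => .halt

/-- From the configuration `s`, the machine `decider N b r` halts with output `y`. -/
def HaltsWith (N : ℕ) (b : ℕ → ℝ) (r : ℝ) (B : Set (List ℝ)) (s : Config (Node N))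
    (y : List ℝ) : Prop :=
  ∃ t : ℕ, (decider N b r).instr (((decider N b r).step B)^[t] s).node = Instr.halt ∧
    Stores (((decider N b r).step B)^[t] s).cell 0 y

/-! ### Runs of the machine -/

section Run

variable {N : ℕ} {b : ℕ → ℝ} {r : ℝ} {B : Set (List ℝ)} {i j : ℕ} {c : ℕ → ℝ} {y : List ℝ}

theorem HaltsWith.of_step {s s' : Config (Node N)} (hs : (decider N b r).step B s = s')
    (h : HaltsWith N b r B s' y) : HaltsWith N b r B s y := by
  obtain ⟨t, ht⟩ := h
  subst hs
  exact ⟨t + 1, ht⟩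

theorem stores_singleton_iff {a : ℕ} {z : ℝ} :
    Stores c a [z] ↔ c a = 1 ∧ c (a + 1) = z := by
  constructor
  · rintro ⟨h1, h2⟩
    exact ⟨by simpa using h1, by simpa using h2 0 (by simp)⟩
  · rintro ⟨h1, h2⟩
    refine ⟨by simpa using h1, fun k hk => ?_⟩
    obtain rfl : k = 0 := by simpa using hk
    simpa using h2

theorem haltsWith_answerLen (ans : Bool) :
    HaltsWith N b r B ⟨.answerLen ans, i, j, c⟩ [if ans then 1 else 0] := by
  refine ⟨2, rfl, ?_⟩
  change Stores (Function.update (Function.update c 0 1) 1 _) 0 _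
  rw [stores_singleton_iff]
  simp

/-- The contents of the cells in the reading phase. -/
structure CellsAre (c : ℕ → ℝ) (x a v : ℝ) : Prop where
  input : c 1 = x
  unit : c 2 = 1
  acc : c 3 = a
  rest : c 4 = v
  base : c 6 = 10

theorem step_compare (k : Fin 5) :
    (decider N b r).step B ⟨Node.compare k, i, j, c⟩ =
      (⟨if c 5 < 0 then .take k else if c 5 = 0 then .decrement k else .decrement k, i, j, c⟩ :
        Config (Node N)) :=
  rfl

/-- The node index `k` counts the subtractions of one already made and `n` those still to come.
Since `k + n = d ≤ 4`, the successor in `Fin 5` never wraps around. -/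
theorem haltsWith_read {x a w : ℝ} (hw0 : 0 ≤ w) (hw1 : w < 1) (n : ℕ) (k d : Fin 5)
    (hkd : (k : ℕ) + n = d) (hc : CellsAre c x a (n + w))
    (h : ∀ c', CellsAre c' x a (w * 10) → HaltsWith N b r B ⟨.exec d, i, j, c'⟩ y) :
    HaltsWith N b r B ⟨.read k, i, j, c⟩ y := by
  induction n generalizing c k with
  | zero =>
    obtain rfl : k = d := Fin.ext hkd
    have hc4 : c 4 = w := by simpa using hc.rest
    refine .of_step (s' := ⟨.compare k, i, j, Function.update c 5 (c 4 - c 2)⟩) rfl ?_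
    refine .of_step (step_compare k) ?_
    rw [Function.update_self, if_pos (by rw [hc4, hc.unit]; linarith)]
    refine .of_step (s' := ⟨.exec k, i, j, Function.update (Function.update c 5 (c 4 - c 2)) 4
      (c 4 * c 6)⟩) rfl (h _ ⟨?_, ?_, ?_, ?_, ?_⟩) <;>
      simp [hc.input, hc.unit, hc.acc, hc4, hc.base]
  | succ n ih =>
    have hc4 := hc.rest
    push_cast at hc4
    refine .of_step (s' := ⟨.compare k, i, j, Function.update c 5 (c 4 - c 2)⟩) rfl ?_
    refine .of_step (step_compare k) ?_
    rw [Function.update_self, ite_self, if_neg (by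
      have := n.cast_nonneg (α := ℝ)
      rw [hc4, hc.unit]
      linarith)]
    refine .of_step (s' := ⟨.read (k + 1), i, j, Function.update (Function.update c 5 (c 4 - c 2)) 4
      (c 4 - c 2)⟩) rfl (ih (k + 1) (by omega) ⟨?_, ?_, ?_, ?_, ?_⟩) <;>
      simp [hc.input, hc.unit, hc.acc, hc4, hc.base]
    ring

variable {g : ℕ → List (Fin 5) × Bool}

theorem haltsWith_read_stream {x a : ℝ} {σ : ℕ × List (Fin 5)}
    (hc : CellsAre c x a (streamValue g σ))
    (h : ∀ c', CellsAre c' x a (streamValue g (streamNext g σ)) →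
      HaltsWith N b r B ⟨.exec (streamHead g σ), i, j, c'⟩ y) :
    HaltsWith N b r B ⟨.read 0, i, j, c⟩ y := by
  refine haltsWith_read (w := streamValue g (streamNext g σ) / 10)
    (div_nonneg (streamValue_nonneg g _) (by norm_num)) ?_ (streamHead g σ) 0 (streamHead g σ)
    (by simp) (by rwa [← streamValue_eq]) ?_
  · have := streamValue_lt g (streamNext g σ)
    linarith
  · rwa [div_mul_cancel₀ _ (by norm_num : (10 : ℝ) ≠ 0)]

theorem haltsWith_exec_of_lt {x a v : ℝ} {k : Fin 5} (hk : k < 3) (hc : CellsAre c x a v)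
    (h : ∀ c', CellsAre c' x (opEval x a k) v → HaltsWith N b r B ⟨.read 0, i, j, c'⟩ y) :
    HaltsWith N b r B ⟨.exec k, i, j, c⟩ y := by
  have hupdate : CellsAre (Function.update c 3 (opEval x a k)) x (opEval x a k) v :=
    ⟨by simp [hc.input], by simp [hc.unit], by simp, by simp [hc.rest], by simp [hc.base]⟩
  refine .of_step ?_ (h _ hupdate)
  rw [← hc.acc, ← hc.input]
  match k, hk with
  | 0, _ => rfl
  -- The machine adds the content of cell `2`, which is one.
  | 1, _ => rw [opEval, ← hc.unit]; rfl
  | 2, _ => rw [opEval, ← hc.unit]; rfl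

theorem haltsWith_read_program {x a : ℝ} {m : ℕ} {l : List (Fin 5)} (hl : ∀ k ∈ l, k < 3)
    (hc : CellsAre c x a (streamValue g (m, l)))
    (h : ∀ c', CellsAre c' x (l.foldl (opEval x) a) (streamValue g (m, [])) →
      HaltsWith N b r B ⟨.read 0, i, j, c'⟩ y) :
    HaltsWith N b r B ⟨.read 0, i, j, c⟩ y := by
  induction l generalizing a c with
  | nil => exact h c hc
  | cons k l ih =>
    refine haltsWith_read_stream hc fun c' hc' => ?_
    refine haltsWith_exec_of_lt (hl k List.mem_cons_self) hc' fun c'' hc'' => ?_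
    exact ih (fun k' hk' => hl k' (List.mem_cons_of_mem _ hk')) hc'' h

theorem step_exec_test (ans : Bool) :
    (decider N b r).step B ⟨Node.exec (if ans then 3 else 4), i, j, c⟩ =
      (⟨if c 3 < 0 then .clear else if c 3 = 0 then .answerLen ans else .clear, i, j, c⟩ :
        Config (Node N)) := by
  cases ans <;> rfl

theorem haltsWith_read_test {x a : ℝ} {m : ℕ} (hc : CellsAre c x a (streamValue g (m, [])))
    (hzero : a = 0 → y = [if (g m).2 then 1 else 0])
    (h : a ≠ 0 → ∀ c', CellsAre c' x 0 (streamValue g (m + 1, (g (m + 1)).1)) →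
      HaltsWith N b r B ⟨.read 0, i, j, c'⟩ y) :
    HaltsWith N b r B ⟨.read 0, i, j, c⟩ y := by
  refine haltsWith_read_stream hc fun c' hc' => ?_
  rw [streamHead]
  refine .of_step (step_exec_test _) ?_
  rw [hc'.acc]
  by_cases ha : a = 0
  · rw [if_neg ha.not_lt, if_pos ha, hzero ha]
    exact haltsWith_answerLen _
  · rw [if_neg ha, ite_self]
    refine .of_step (s' := ⟨.read 0, i, j, Function.update c' 3 0⟩) rfl
      (h ha _ ⟨?_, ?_, ?_, ?_, ?_⟩)
    · simpa using hc'.input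
    · simpa using hc'.unit
    · simp
    · simpa [streamNext] using hc'.rest
    · simpa using hc'.base

/-- The reading phase finds the first program that vanishes at `x`. -/
theorem haltsWith_read_programs {x : ℝ} (hg : ∀ m, ∀ k ∈ (g m).1, k < 3)
    (hans : ∀ m, progEval (g m).1 x = 0 → y = [if (g m).2 then 1 else 0])
    (n m : ℕ) (hex : progEval (g (m + n)).1 x = 0)
    (hc : CellsAre c x 0 (streamValue g (m, (g m).1))) :
    HaltsWith N b r B ⟨.read 0, i, j, c⟩ y := by
  induction n generalizing m c with
  | zero =>
    refine haltsWith_read_program (hg m) hc fun c' hc' => ?_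
    exact haltsWith_read_test hc' (hans m) fun hne => absurd hex hne
  | succ n ih =>
    refine haltsWith_read_program (hg m) hc fun c' hc' => ?_
    refine haltsWith_read_test hc' (hans m) fun _ c'' hc'' => ?_
    exact ih (m + 1) (by rwa [add_right_comm, add_assoc]) hc''

theorem haltsWith_initAcc {x : ℝ} (hg : ∀ m, ∀ k ∈ (g m).1, k < 3)
    (hans : ∀ m, progEval (g m).1 x = 0 → y = [if (g m).2 then 1 else 0])
    (hex : ∃ m, progEval (g m).1 x = 0) (hc1 : c 1 = x) (hc2 : c 2 = 1) :
    HaltsWith N b (streamValue g (0, (g 0).1)) B ⟨.initAcc, i, j, c⟩ y := by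
  obtain ⟨n, hn⟩ := hex
  refine .of_step (s' := ⟨.initStream, i, j, Function.update c 3 0⟩) rfl ?_
  refine .of_step (s' := ⟨.initBase, i, j, Function.update (Function.update c 3 0) 4
    (streamValue g (0, (g 0).1))⟩) rfl ?_
  refine .of_step (s' := ⟨.read 0, i, j, Function.update (Function.update (Function.update c 3 0) 4
    (streamValue g (0, (g 0).1))) 6 10⟩) rfl ?_
  refine haltsWith_read_programs hg hans n 0 (by rwa [zero_add]) ⟨?_, ?_, ?_, ?_, ?_⟩ <;>
    simp [hc1, hc2]

open Classical in
theorem step_ask (n : Fin (N + 1)) :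
    (decider N b r).step B ⟨Node.ask n, i, j, c⟩ =
      (⟨if ∃ z ∈ B, Stores c 2 z then .initAcc else
        if h : (n : ℕ) < N then .load ⟨n + 1, Nat.succ_lt_succ h⟩ else .answerLen false, i, j, c⟩ :
        Config (Node N)) :=
  rfl

variable {T : Set ℕ}

theorem exists_stores_algebraicOfDegree_iff {a : ℕ} (h : c a = 1) :
    (∃ z ∈ algebraicOfDegree T, Stores c a z) ↔
      IsAlgebraic ℚ (c (a + 1)) ∧ (minpoly ℚ (c (a + 1))).natDegree ∈ T := by
  constructor
  · rintro ⟨_, ⟨z, rfl, hz⟩, hst⟩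
    rw [(stores_singleton_iff.1 hst).2]
    exact hz
  · intro hz
    exact ⟨_, ⟨_, rfl, hz⟩, stores_singleton_iff.2 ⟨h, rfl⟩⟩

/-- The querying phase. -/
theorem haltsWith_load {x : ℝ}
    (hyes : ∀ n, n ≤ N → IsAlgebraic ℚ (x + b n) → ∀ c : ℕ → ℝ, c 1 = x → c 2 = 1 →
      HaltsWith N b r (algebraicOfDegree T) ⟨.initAcc, i, j, c⟩ y)
    (hno : (∀ n, n ≤ N → ¬(IsAlgebraic ℚ (x + b n) ∧ (minpoly ℚ (x + b n)).natDegree ∈ T)) →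
      y = [0])
    (e : ℕ) (n : Fin (N + 1)) (hn : (n : ℕ) + e = N)
    (hprev : ∀ m, m < (n : ℕ) → ¬(IsAlgebraic ℚ (x + b m) ∧ (minpoly ℚ (x + b m)).natDegree ∈ T))
    (hc1 : c 1 = x) (hc2 : c 2 = 1) :
    HaltsWith N b r (algebraicOfDegree T) ⟨.load n, i, j, c⟩ y := by
  induction e generalizing n c with
  | zero | succ e ih =>
    refine .of_step (s' := ⟨.translate n, i, j, Function.update c 4 (b n)⟩) rfl ?_
    refine .of_step (s' := ⟨.ask n, i, j, Function.update (Function.update c 4 (b n)) 3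
      (Function.update c 4 (b n) 1 + Function.update c 4 (b n) 4)⟩) rfl ?_
    rw [Function.update_self, Function.update_of_ne (by decide), hc1]
    set c' := Function.update (Function.update c 4 (b n)) 3 (x + b n) with hc'
    have hc'1 : c' 1 = x := by simp [hc', hc1]
    have hc'2 : c' 2 = 1 := by simp [hc', hc2]
    have hc'3 : c' (2 + 1) = x + b n := by simp [hc']
    refine .of_step (step_ask n) ?_
    rw [exists_stores_algebraicOfDegree_iff hc'2, hc'3]
    by_cases hq : IsAlgebraic ℚ (x + b n) ∧ (minpoly ℚ (x + b n)).natDegree ∈ T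
    · rw [if_pos hq]
      exact hyes n (by omega) hq.1 c' hc'1 hc'2
    · have hprev' : ∀ m, m < (n : ℕ) + 1 →
          ¬(IsAlgebraic ℚ (x + b m) ∧ (minpoly ℚ (x + b m)).natDegree ∈ T) := by
        intro m hm
        rcases Nat.lt_succ_iff_lt_or_eq.1 hm with hm | rfl
        · exact hprev m hm
        · exact hq
      rw [if_neg hq]
      -- The alternatives are the last query, `n = N`, and an earlier one.
      first
      | rw [dif_neg (by omega), hno fun m hm => hprev' m (by omega)]
        exact haltsWith_answerLen false
      | rw [dif_pos (by omega)]
        exact ih _ (by simp only; omega) hprev' hc'1 hc'2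

theorem step_lenFork :
    (decider N b r).step B ⟨Node.lenFork, i, j, c⟩ =
      (⟨if c 3 < 0 then .answerLen false else if c 3 = 0 then .load 0 else .answerLen false,
        i, j, c⟩ : Config (Node N)) :=
  rfl

theorem haltsWith_start_of_ne (h : c 0 ≠ 1) : HaltsWith N b r B ⟨.start, i, j, c⟩ [0] := by
  refine .of_step (s' := ⟨.lenSub, i, j, Function.update c 2 1⟩) rfl ?_
  refine .of_step (s' := ⟨.lenFork, i, j, Function.update (Function.update c 2 1) 3
    (c 0 - 1)⟩) rfl ?_
  refine .of_step step_lenFork ?_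
  rw [Function.update_self, if_neg (sub_ne_zero.2 h), ite_self]
  exact haltsWith_answerLen false

theorem haltsWith_start_of_eq (h : c 0 = 1)
    (hload : ∀ c', c' 1 = c 1 → c' 2 = 1 → HaltsWith N b r B ⟨.load 0, i, j, c'⟩ y) :
    HaltsWith N b r B ⟨.start, i, j, c⟩ y := by
  refine .of_step (s' := ⟨.lenSub, i, j, Function.update c 2 1⟩) rfl ?_
  refine .of_step (s' := ⟨.lenFork, i, j, Function.update (Function.update c 2 1) 3
    (c 0 - 1)⟩) rfl ?_
  refine .of_step step_lenFork ?_
  rw [Function.update_self, if_neg (by linarith), if_pos (by linarith)]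
  exact hload _ (by simp) (by simp)

end Run

/-! ### Correctness and conclusion -/

/-- The machine `decider` decides `algebraicOfDegree S`, if the translations by the algebraic numbers
`b n` detect all elements of this set. -/
theorem decider_computes {S T : Set ℕ} {N : ℕ} {b : ℕ → ℝ} (hb : ∀ n, IsAlgebraic ℚ (b n))
    (hdetect : ∀ x : ℝ, IsAlgebraic ℚ x → (minpoly ℚ x).natDegree ∈ S →
      ∃ n ≤ N, (minpoly ℚ (x + b n)).natDegree ∈ T)
    {g : ℕ → List (Fin 5) × Bool} (hg : ∀ m, Sound S (g m))
    (hex : ∀ x : ℝ, IsAlgebraic ℚ x → ∃ m, progEval (g m).1 x = 0) :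
    (decider N b (streamValue g (0, (g 0).1))).Computes (algebraicOfDegree T)
      (charFun (algebraicOfDegree S)) := by
  intro xs
  change HaltsWith N b (streamValue g (0, (g 0).1)) (algebraicOfDegree T)
    ⟨.start, 0, 0, fun k => if k = 0 then (xs.length : ℝ) else xs.getD (k - 1) 0⟩ _
  by_cases hlen : xs.length = 1
  · obtain ⟨x, rfl⟩ := List.length_eq_one_iff.1 hlen
    have hmem : [x] ∈ algebraicOfDegree S ↔ IsAlgebraic ℚ x ∧ (minpoly ℚ x).natDegree ∈ S := by
      simp [algebraicOfDegree]
    refine haltsWith_start_of_eq (by simp) fun c hc1 hc2 => ?_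
    refine haltsWith_load (x := x) (fun n _ hn c hc1 hc2 => ?_) (fun h => ?_) N 0 (by simp)
      (fun m hm => absurd hm (Nat.not_lt_zero m)) (by simpa using hc1) hc2
    -- Any positive answer makes `x = (x + b n) - b n` algebraic, so the search will end.
    · have hx : IsAlgebraic ℚ x := by simpa using hn.sub (hb n)
      refine haltsWith_initAcc (fun m => (hg m).1) (fun m hm => ?_) (hex x hx) hc1 hc2
      have hiff : [x] ∈ algebraicOfDegree S ↔ (g m).2 = true := by
        rw [hmem, (hg m).2 x hm, and_iff_right hx]
      simp only [charFun, hiff]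
      split_ifs <;> rfl
    · rw [charFun, if_neg]
      rw [hmem]
      rintro ⟨hx, hS⟩
      obtain ⟨n, hn, hT⟩ := hdetect x hx hS
      exact h n hn ⟨hx.add (hb n), hT⟩
  · have hnot : xs ∉ algebraicOfDegree S := by
      rintro ⟨x, rfl, -⟩
      exact hlen rfl
    rw [charFun, if_neg hnot]
    exact haltsWith_start_of_ne (by simpa using hlen)

end BSS

theorem proposition5p8 (S T : Set ℕ) (hS : ∀ d ∈ S, 0 < d) (hT : ∀ d ∈ T, 0 < d)
    (N : ℕ)
    (h : ∀ d ∈ S, ∃ n : ℕ, 0 < n ∧ n ≤ N ∧ Nat.Coprime n d ∧ d * n ∈ T) :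
    BSS.Reducible (BSS.algebraicOfDegree S) (BSS.algebraicOfDegree T) := by
  have hb (n : ℕ) : ∃ x : ℝ, IsAlgebraic ℚ x ∧ (0 < n → (minpoly ℚ x).natDegree = n) := by
    rcases n.eq_zero_or_pos with rfl | hn
    -- The machine also queries `x + b 0`; of `b 0` only algebraicity is needed.
    · exact ⟨0, isAlgebraic_zero, fun h => absurd h (lt_irrefl 0)⟩
    · obtain ⟨x, hx, hdeg⟩ := exists_real_natDegree_minpoly_eq hn
      exact ⟨x, hx, fun _ => hdeg⟩
  choose b hb hdeg using hb
  obtain ⟨g, hg, hex⟩ := BSS.exists_sound_enumeration S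
  refine ⟨_, BSS.decider_computes (N := N) hb (fun x hx hxS => ?_) hg hex⟩
  obtain ⟨n, hn, hnN, hcop, hnT⟩ := h _ hxS
  refine ⟨n, hnN, ?_⟩
  rw [natDegree_minpoly_add hx.isIntegral (hb n).isIntegral (by rw [hdeg n hn]; exact hcop.symm),
    hdeg n hn]
  exact hnT
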